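/- Let $A$ be a finite nonempty alphabet and let $S\subseteq A^*$ be a set of words containing every letter of $A$. Assume that $S$ is uniformly recurrent, i.e. $S$ contains all factors of its elements, for every $w\in S$ there is a letter $a\in A$ with $wa\in S$, and for every $u\in S$ there is an integer $n\ge 1$ such that $u$ is a factor of every word of $S$ of length $n$. A bifix code is a set of nonempty words which contains no proper prefix and no proper suffix of any of its elements. A bifix code $X\subseteq S$ is $S$-maximal if it is not properly contained in any bifix code $Y\subseteq S$. A parse of a word $w$ with respect to $X$ is a triple $(v,x,u)$ with $w=vxu$ such that $v$ has no suffix in $X$, $u$ has no prefix in $X$ and $x\in X^*$, the submonoid generated by $X$. The $S$-degree of $X$ is the maximal number of parses with respect to $X$ of a word of $S$. Suppose that for every integer $d$, every finite $S$-maximal bifix code $X\subseteq S$ of $S$-degree $d$ has exactly $d(\operatorname{Card}(A)-1)+1$ elements. Then $S$ is neutral, that is, $S$ contains all factors of its elements and every $w\in S$ satisfies $$\operatorname{Card}\{(a,b)\in A\times A: awb\in S\}-\operatorname{Card}\{a\in A: aw\in S\}-\operatorname{Card}\{a\in A: wa\in S\}+1=0 .$$ -/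

import Mathlib

/-! Words over an alphabet `A` are lists `List A`; sets of words are `Set (List A)`. -/

namespace BifixWords

variable {A : Type*}

/-- `S` contains the factors of its elements. -/
def IsFactorial (S : Set (List A)) : Prop :=
  ∀ w ∈ S, ∀ u : List A, u <:+: w → u ∈ S

/-- `L(w)`, the letters `a` with `aw ∈ S`. -/
def leftExt (S : Set (List A)) (w : List A) : Set A :=
  {a | a :: w ∈ S}

/-- `R(w)`, the letters `a` with `wa ∈ S`. -/
def rightExt (S : Set (List A)) (w : List A) : Set A :=
  {a | w ++ [a] ∈ S}

/-- `E(w)`, the pairs of letters `(a, b)` with `awb ∈ S`. -/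
def biExt (S : Set (List A)) (w : List A) : Set (A × A) :=
  {p | p.1 :: (w ++ [p.2]) ∈ S}

/-- `S` is factorial and each of its words can be extended on the right by a letter. -/
def IsRightExtendable (S : Set (List A)) : Prop :=
  IsFactorial S ∧ ∀ w ∈ S, (rightExt S w).Nonempty

/-- `S` is right-extendable, and every `u ∈ S` is a factor of all words of `S` of some
length `n ≥ 1`. -/
def IsUniformlyRecurrent (S : Set (List A)) : Prop :=
  IsRightExtendable S ∧
    ∀ u ∈ S, ∃ n : ℕ, 1 ≤ n ∧ ∀ w ∈ S, w.length = n → u <:+: w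

/-- The multiplicity `m(w) = e(w) - ℓ(w) - r(w) + 1` of `w` in `S`. -/
noncomputable def wordMult (S : Set (List A)) (w : List A) : ℤ :=
  ((biExt S w).ncard : ℤ) - (leftExt S w).ncard - (rightExt S w).ncard + 1

/-- `S` is factorial and all its words are neutral. -/
def IsNeutral (S : Set (List A)) : Prop :=
  IsFactorial S ∧ ∀ w ∈ S, wordMult S w = 0

/-- A set of nonempty words containing no proper prefix of its elements. -/
def IsPrefixCode (X : Set (List A)) : Prop :=
  (∀ x ∈ X, x ≠ []) ∧ ∀ x ∈ X, ∀ y ∈ X, x <+: y → x = y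

/-- A set of nonempty words containing no proper suffix of its elements. -/
def IsSuffixCode (X : Set (List A)) : Prop :=
  (∀ x ∈ X, x ≠ []) ∧ ∀ x ∈ X, ∀ y ∈ X, x <:+ y → x = y

/-- A set which is both a prefix code and a suffix code. -/
def IsBifixCode (X : Set (List A)) : Prop :=
  IsPrefixCode X ∧ IsSuffixCode X

/-- `X ⊆ S` is a bifix code not properly contained in a bifix code `Y ⊆ S`. -/
def IsMaximalBifixCode (S X : Set (List A)) : Prop :=
  Maximal (fun Y : Set (List A) => Y ⊆ S ∧ IsBifixCode Y) X

/-- The submonoid `X^*` generated by `X`: all concatenations of finite lists of elements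
of `X`. -/
def wordStar (X : Set (List A)) : Set (List A) :=
  {w | ∃ l : List (List A), (∀ x ∈ l, x ∈ X) ∧ w = l.flatten}

/-- The set of parses of `w` with respect to `X`: triples `(v, x, u)` with `w = vxu`, where
`v` has no suffix in `X`, `u` has no prefix in `X` and `x` lies in the submonoid `X^*`. -/
def parses (X : Set (List A)) (w : List A) : Set (List A × List A × List A) :=
  {p | w = p.1 ++ p.2.1 ++ p.2.2 ∧ (∀ s ∈ X, ¬ s <:+ p.1) ∧
    p.2.1 ∈ wordStar X ∧ ∀ s ∈ X, ¬ s <+: p.2.2}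

/-- The `S`-degree `d_X(S)`: the maximal number of parses, with respect to `X`, of a word
of `S` (possibly infinite). -/
noncomputable def degree (S X : Set (List A)) : ℕ∞ :=
  ⨆ w ∈ S, (parses X w).encard

end BifixWords

/-!
Write `k` for the number of letters. For `n ≥ 1` the set `S ∩ Aⁿ` is a finite `S`-maximal bifix
code of degree `n`, so the hypothesis gives `n (k - 1) + 1` words of length `n` in `S`. For `n = 2`
this says that the empty word has multiplicity zero.

Let now `z ∈ S` be a nonempty word of length `N`, and suppose `k ≥ 2`. The *internal
transformation* of `S ∩ Aᴺ⁺¹` relative to `z` removes the words `bz` and `zc`, and adds `z` together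
with the words `bxc` of `S` in which `x` is a maximal run of `z`, a run being a word whose only
factor of length `N` is `z`. The result is again a finite `S`-maximal bifix code of degree `N + 1`
(`isMaximalBifixCode_internalTransform`, `degree_internalTransform`), so by hypothesis it has as
many elements as `S ∩ Aᴺ⁺¹`. Hence, `T z` being the number of words `bxc` above,
`T z + 1 = r(z) + ℓ(z) - q`, where `q` counts the words of `S` of length `N + 1` with `z` both as
prefix and as suffix (`ncard_maximalRuns`).

If `q = 0`, then the only run of `z` in `S` is `z`, so `T z = e(z)` and `m(z) = 0`. Otherwise
`z = aᴺ` for a letter `a` with `aᴺ⁺¹ ∈ S`, and `q = 1`. Then `T z - T (za)` is the number of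
`bzc ∈ S` with `b, c ≠ a`; the remaining `bzc ∈ S` are the words of the form `(za)c` or `b(za)`,
whose number is `T (za) + 1` by the same identity for `za`. So `e(z) = T z + 1 = r(z) + ℓ(z) - 1`
(`wordMult_of_ne_nil`).

The degree is computed from the fact that the parses of `w` with respect to a suffix code
correspond to the suffixes of `w` without prefix in the code (`encard_parses`).
-/

namespace BifixWords

variable {A : Type*} {S C : Set (List A)} {z : List A}

/-! ### Maximality and degree of a bifix code -/

/-- A bifix code is `S`-maximal as soon as every word of `S` has an extension in `S` with a
prefix in the code: a further word of a larger prefix code would be comparable to that prefix. -/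
theorem isMaximalBifixCode_of_dense (hC : IsBifixCode C) (hCS : C ⊆ S)
    (hd : ∀ y ∈ S, ∃ w, y <+: w ∧ ∃ p ∈ C, p <+: w) : IsMaximalBifixCode S C := by
  refine ⟨⟨hCS, hC⟩, ?_⟩
  rintro Y ⟨hYS, hY⟩ hCY y hy
  obtain ⟨w, hyw, p, hp, hpw⟩ := hd y (hYS hy)
  rcases List.prefix_or_prefix_of_prefix hyw hpw with h | h
  · rwa [hY.1.2 y hy p (hCY hp) h]
  · rwa [← hY.1.2 p (hCY hp) y hy h]

/-- For a suffix code `C`, the decomposition `v ++ x` of a word with `x ∈ C^*` and `v` without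
suffix in `C` is unique. -/
theorem decomposition_unique (hC : IsSuffixCode C) (l l' : List (List A)) (v v' : List A)
    (hl : ∀ x ∈ l, x ∈ C) (hl' : ∀ x ∈ l', x ∈ C) (hv : ∀ s ∈ C, ¬ s <:+ v)
    (hv' : ∀ s ∈ C, ¬ s <:+ v') (h : v ++ l.flatten = v' ++ l'.flatten) :
    v = v' ∧ l.flatten = l'.flatten := by
  induction l using List.reverseRecOn generalizing l' with
  | nil =>
    rcases List.eq_nil_or_concat l' with rfl | ⟨m, y, rfl⟩
    · simpa using h
    · refine absurd ⟨v' ++ m.flatten, ?_⟩ (hv y (hl' y (by simp)))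
      simpa using h.symm
  | append_singleton k x ih =>
    rcases List.eq_nil_or_concat l' with rfl | ⟨m, y, rfl⟩
    · refine absurd ⟨v ++ k.flatten, ?_⟩ (hv' x (hl x (by simp)))
      simpa using h
    · have hx := hl x (by simp)
      have hy := hl' y (by simp)
      have h' : (v ++ k.flatten) ++ x = (v' ++ m.flatten) ++ y := by simpa using h
      have hxy : x = y := by
        rcases List.suffix_or_suffix_of_suffix
          (⟨_, h'⟩ : x <:+ (v' ++ m.flatten) ++ y) ⟨_, rfl⟩ with hs | hs
        · exact hC.2 x hx y hy hs
        · exact (hC.2 y hy x hx hs).symm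
      subst hxy
      have := ih m (fun x hx => hl x (by simp [hx])) (fun x hx => hl' x (by simp [hx]))
        (List.append_cancel_right h')
      simpa using this

theorem exists_decomposition (hC : ∀ x ∈ C, x ≠ []) (w : List A) :
    ∃ v x, w = v ++ x ∧ (∀ s ∈ C, ¬ s <:+ v) ∧ x ∈ wordStar C := by
  induction hn : w.length using Nat.strong_induction_on generalizing w with
  | _ n ih =>
    by_cases h : ∀ s ∈ C, ¬ s <:+ w
    · exact ⟨w, [], by simp, h, [], by simp, by simp⟩
    · push Not at h
      obtain ⟨s, hs, t, rfl⟩ := h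
      have hpos := List.length_pos_iff.mpr (hC s hs)
      obtain ⟨v, x, rfl, hv, l, hl, rfl⟩ :=
        ih t.length (by simp at hn; omega) t rfl
      refine ⟨v, l.flatten ++ s, by simp, hv, l ++ [s], ?_, by simp⟩
      intro x hx
      rcases List.mem_append.mp hx with hx | hx
      · exact hl x hx
      · simp at hx; exact hx ▸ hs

/-- With respect to a suffix code, the parses `(v, x, u)` of `w` correspond to the suffixes `u`
of `w` without prefix in the code. -/
theorem encard_parses (hC : IsSuffixCode C) (w : List A) :
    (parses C w).encard = {u | u <:+ w ∧ ∀ s ∈ C, ¬ s <+: u}.encard := by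
  have hinj : Set.InjOn (fun p : List A × List A × List A => p.2.2) (parses C w) := by
    rintro ⟨v, x, u⟩ ⟨h, hv, ⟨l, hl, rfl⟩, -⟩ ⟨v', x', u'⟩ ⟨h', hv', ⟨l', hl', rfl⟩, -⟩ huu
    obtain rfl : u = u' := huu
    obtain ⟨rfl, hx⟩ := decomposition_unique hC l l' v v' hl hl' hv hv'
      (List.append_cancel_right (h.symm.trans h'))
    simp [hx]
  rw [← hinj.encard_image]
  congr 1
  ext u
  constructor
  · rintro ⟨⟨v, x, u⟩, ⟨h, -, -, hu⟩, rfl⟩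
    exact ⟨⟨v ++ x, h.symm⟩, hu⟩
  · rintro ⟨⟨t, rfl⟩, hu⟩
    obtain ⟨v, x, rfl, hv, hx⟩ := exists_decomposition hC.1 t
    exact ⟨(v, x, u), ⟨rfl, hv, hx, hu⟩, rfl⟩

theorem suffix_eq_of_length_eq {u v w : List A} (hu : u <:+ w) (hv : v <:+ w)
    (h : u.length = v.length) : u = v :=
  (List.suffix_of_suffix_length_le hu hv h.le).eq_of_length h

/-- The degree is `N + 1` when a word of `S` has at most one suffix of length at least `N`
without prefix in `C`, and some word of length `N` of `S` has no factor in `C`. -/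
theorem degree_eq (hC : IsSuffixCode C) {N : ℕ}
    (hle : ∀ w ∈ S, ∀ u v, u <:+ w → v <:+ u → N ≤ v.length → v.length < u.length →
      (∀ s ∈ C, ¬ s <+: u) → ∃ s ∈ C, s <+: v)
    {y : List A} (hyS : y ∈ S) (hy : y.length = N) (hyC : ∀ s ∈ C, ¬ s <:+: y) :
    degree S C = (N + 1 : ℕ) := by
  apply le_antisymm
  · refine iSup₂_le fun w hw => ?_
    rw [encard_parses hC]
    -- Suffixes are counted by their length, all lengths from `N` on being identified.
    have hinj : Set.InjOn (fun u : List A => min u.length N)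
        {u | u <:+ w ∧ ∀ s ∈ C, ¬ s <+: u} := by
      rintro u ⟨hu, hu'⟩ v ⟨hv, hv'⟩ huv
      simp only at huv
      rcases lt_trichotomy u.length v.length with h | h | h
      · obtain ⟨s, hs, hsu⟩ := hle w hw v u hv
          (List.suffix_of_suffix_length_le hu hv h.le) (by omega) h hv'
        exact absurd hsu (hu' s hs)
      · exact suffix_eq_of_length_eq hu hv h
      · obtain ⟨s, hs, hsu⟩ := hle w hw u v hu
          (List.suffix_of_suffix_length_le hv hu h.le) (by omega) h hu'
        exact absurd hsu (hv' s hs)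
    rw [← hinj.encard_image]
    calc _ ≤ (↑(Finset.range (N + 1)) : Set ℕ).encard := by
          apply Set.encard_le_encard
          rintro _ ⟨u, -, rfl⟩
          simp
      _ = _ := by rw [Set.encard_coe_eq_coe_finsetCard, Finset.card_range]
  · refine le_trans ?_ (le_iSup₂ (f := fun w _ => (parses C w).encard) y hyS)
    rw [encard_parses hC]
    have hinj : Set.InjOn (fun i => y.drop i) (↑(Finset.range (N + 1)) : Set ℕ) := by
      intro i hi j hj hij
      have := congrArg List.length hij
      simp at this hi hj
      omega
    calc ((N + 1 : ℕ) : ℕ∞) = (↑(Finset.range (N + 1)) : Set ℕ).encard := by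
          rw [Set.encard_coe_eq_coe_finsetCard, Finset.card_range]
      _ = _ := hinj.encard_image.symm
      _ ≤ _ := by
          apply Set.encard_le_encard
          rintro _ ⟨i, -, rfl⟩
          exact ⟨List.drop_suffix i y, fun s hs hsy =>
            hyC s hs (hsy.isInfix.trans (List.drop_suffix i y).isInfix)⟩

/-! ### Extensions of words -/

theorem append_singleton_suffix_iff {u v : List A} {b c : A} :
    u ++ [b] <:+ v ++ [c] ↔ u <:+ v ∧ b = c := by
  rw [← List.reverse_prefix, List.reverse_concat, List.reverse_concat, List.cons_prefix_cons,
    List.reverse_prefix, and_comm]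

theorem exists_extension (hS : IsRightExtendable S) {w : List A} (hw : w ∈ S) (n : ℕ) :
    ∃ t, w ++ t ∈ S ∧ t.length = n := by
  induction n with
  | zero => exact ⟨[], by simpa using hw, rfl⟩
  | succ n ih =>
    obtain ⟨t, ht, hn⟩ := ih
    obtain ⟨a, ha⟩ := hS.2 _ ht
    exact ⟨t ++ [a], by simpa [rightExt] using ha, by simp [hn]⟩

theorem finite_of_length_le [Finite A] {X : Set (List A)} {n : ℕ}
    (h : ∀ x ∈ X, x.length ≤ n) : X.Finite :=
  (List.finite_length_le A n).subset h

/-- The words of length `n` of `S`. -/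
def wordsOfLength (S : Set (List A)) (n : ℕ) : Set (List A) :=
  {x | x ∈ S ∧ x.length = n}

theorem isBifixCode_wordsOfLength (S : Set (List A)) (n : ℕ) :
    IsBifixCode (wordsOfLength S (n + 1)) := by
  have h0 : ∀ x ∈ wordsOfLength S (n + 1), x ≠ [] := by
    rintro x ⟨-, h⟩ rfl
    simp at h
  exact ⟨⟨h0, fun x hx y hy h => h.eq_of_length (hx.2.trans hy.2.symm)⟩,
    h0, fun x hx y hy h => h.eq_of_length (hx.2.trans hy.2.symm)⟩

theorem isMaximalBifixCode_wordsOfLength (hS : IsRightExtendable S) (n : ℕ) :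
    IsMaximalBifixCode S (wordsOfLength S (n + 1)) := by
  refine isMaximalBifixCode_of_dense (isBifixCode_wordsOfLength S n) (fun x hx => hx.1) ?_
  intro y hy
  obtain ⟨t, ht, hn⟩ := exists_extension hS hy (n + 1)
  refine ⟨y ++ t, List.prefix_append _ _, (y ++ t).take (n + 1), ⟨?_, ?_⟩, List.take_prefix _ _⟩
  · exact hS.1 _ ht _ (List.take_prefix _ _).isInfix
  · simp; omega

theorem degree_wordsOfLength (hS : IsRightExtendable S) (h0 : [] ∈ S) (n : ℕ) :
    degree S (wordsOfLength S (n + 1)) = (n + 1 : ℕ) := by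
  obtain ⟨y, hy, hn⟩ := exists_extension hS h0 n
  refine degree_eq (isBifixCode_wordsOfLength S n).2 ?_ hy (by simpa using hn) ?_
  · intro w hw u v hu hv hnv hvu hC
    refine absurd (List.take_prefix (n + 1) u) (hC _ ⟨hS.1 _ hw _ ?_, by simp; omega⟩)
    exact (List.take_prefix _ _).isInfix.trans hu.isInfix
  · intro s hs h
    have := h.length_le
    have := hs.2
    simp at *
    omega

/-! ### Internal transformation of the words of given length -/

/-- The words, of length at least `z.length`, whose only factor of length `z.length` is `z`. For
nonempty `z` this is `{z}`, unless `z` is a power of a letter `a`, when it is the set of powers of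
`a` at least as long as `z`. -/
def runs (z : List A) : Set (List A) :=
  {x | z.length ≤ x.length ∧ ∀ f, f <:+: x → f.length = z.length → f = z}

theorem self_mem_runs (z : List A) : z ∈ runs z :=
  ⟨le_rfl, fun _ h hl => h.eq_of_length hl⟩

theorem runs_of_infix {x y : List A} (hx : x ∈ runs z) (h : y <:+: x)
    (hy : z.length ≤ y.length) : y ∈ runs z :=
  ⟨hy, fun f hf => hx.2 f (hf.trans h)⟩

theorem prefix_of_mem_runs {x : List A} (hx : x ∈ runs z) : z <+: x := by
  rw [← hx.2 (x.take z.length) (List.take_prefix _ _).isInfix (by simpa using hx.1)]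
  exact List.take_prefix _ _

theorem suffix_of_mem_runs {x : List A} (hx : x ∈ runs z) : z <:+ x := by
  have := hx.1
  rw [← hx.2 (x.drop (x.length - z.length)) (List.drop_suffix _ _).isInfix (by simp; omega)]
  exact List.drop_suffix _ _

theorem cons_mem_runs {x : List A} {b : A} (hx : x ∈ runs z) (h : z <+: b :: x) :
    b :: x ∈ runs z := by
  refine ⟨by simpa using Nat.le_succ_of_le hx.1, fun f hf hl => ?_⟩
  rcases List.infix_cons_iff.mp hf with hf | hf
  · exact (List.prefix_of_prefix_length_le hf h hl.le).eq_of_length hl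
  · exact hx.2 f hf hl

theorem concat_mem_runs {x : List A} {c : A} (hx : x ∈ runs z) (h : z <:+ x ++ [c]) :
    x ++ [c] ∈ runs z := by
  refine ⟨by simpa using Nat.le_succ_of_le hx.1, fun f hf hl => ?_⟩
  rcases List.infix_concat_iff.mp hf with hf | hf
  · exact suffix_eq_of_length_eq hf h hl
  · exact hx.2 f hf hl

/-- The words `b x c` of `S` in which `x` is a maximal factor among those in `runs z`. -/
def maximalRuns (S : Set (List A)) (z : List A) : Set (List A) :=
  {t | t ∈ S ∧ ∃ b x c, t = b :: (x ++ [c]) ∧ x ∈ runs z ∧ b :: x ∉ runs z ∧ x ++ [c] ∉ runs z}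

/-- The words `z a` of `S` with `a` a letter. -/
def rightWords (S : Set (List A)) (z : List A) : Set (List A) :=
  {x | x ∈ S ∧ x.length = z.length + 1 ∧ z <+: x}

/-- The words `a z` of `S` with `a` a letter. -/
def leftWords (S : Set (List A)) (z : List A) : Set (List A) :=
  {x | x ∈ S ∧ x.length = z.length + 1 ∧ z <:+ x}

/-- The internal transformation, relative to `z`, of the words of length `z.length + 1` of `S`:
the words with `z` as a prefix or a suffix are replaced by `z` and by the words of
`maximalRuns S z`. -/
def internalTransform (S : Set (List A)) (z : List A) : Set (List A) :=
  wordsOfLength S (z.length + 1) \ (rightWords S z ∪ leftWords S z) ∪ insert z (maximalRuns S z)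

theorem mem_internalTransform {t : List A} : t ∈ internalTransform S z ↔
    (t ∈ S ∧ t.length = z.length + 1 ∧ ¬ z <+: t ∧ ¬ z <:+ t) ∨ t = z ∨ t ∈ maximalRuns S z := by
  simp only [internalTransform, wordsOfLength, rightWords, leftWords, Set.mem_union, Set.mem_sdiff,
    Set.mem_ofPred_eq, Set.mem_insert_iff]
  tauto

theorem mem_rightWords {x : List A} : x ∈ rightWords S z ↔ x ∈ S ∧ ∃ c, x = z ++ [c] := by
  refine and_congr_right fun _ => ⟨?_, ?_⟩
  · rintro ⟨hl, t, rfl⟩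
    obtain ⟨c, rfl⟩ := List.length_eq_one_iff.mp (by simpa using hl)
    exact ⟨c, rfl⟩
  · rintro ⟨c, rfl⟩
    exact ⟨by simp, List.prefix_append _ _⟩

theorem mem_leftWords {x : List A} : x ∈ leftWords S z ↔ x ∈ S ∧ ∃ b, x = b :: z := by
  refine and_congr_right fun _ => ⟨?_, ?_⟩
  · rintro ⟨hl, t, rfl⟩
    obtain ⟨b, rfl⟩ : ∃ b, t = [b] := List.length_eq_one_iff.mp (by simp at hl; omega)
    exact ⟨b, rfl⟩
  · rintro ⟨b, rfl⟩
    exact ⟨by simp, List.suffix_cons _ _⟩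

theorem length_of_mem_maximalRuns {t : List A} (ht : t ∈ maximalRuns S z) :
    z.length + 2 ≤ t.length := by
  obtain ⟨-, b, x, c, rfl, hx, -⟩ := ht
  simpa using hx.1

theorem isPrefixCode_internalTransform (hz : z ≠ []) :
    IsPrefixCode (internalTransform S z) := by
  have hz' := List.length_pos_iff.mpr hz
  constructor
  · rintro t ht rfl
    rcases mem_internalTransform.mp ht with ⟨-, h, -⟩ | h | h
    · simp at h
    · exact hz h.symm
    · simpa using length_of_mem_maximalRuns h
  · intro t ht u hu htu
    have hlen := htu.length_le
    rcases mem_internalTransform.mp ht with ⟨-, h, h1, h2⟩ | rfl | h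
    · rcases mem_internalTransform.mp hu with ⟨-, h', -⟩ | rfl | h'
      · exact htu.eq_of_length (h.trans h'.symm)
      · omega
      · obtain ⟨-, b, x, c, rfl, hx, -⟩ := h'
        refine absurd ?_ h2
        have hp : b :: z <+: b :: (x ++ [c]) :=
          (List.cons_prefix_cons).mpr ⟨rfl, (prefix_of_mem_runs hx).trans (List.prefix_append _ _)⟩
        rw [(List.prefix_of_prefix_length_le htu hp (by simp [h])).eq_of_length (by simp [h])]
        exact List.suffix_cons _ _
    · rcases mem_internalTransform.mp hu with ⟨-, -, h1, -⟩ | rfl | h'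
      · exact absurd htu h1
      · rfl
      · obtain ⟨-, b, x, c, rfl, hx, hbx, -⟩ := h'
        refine absurd (cons_mem_runs hx ?_) hbx
        refine List.prefix_of_prefix_length_le htu (l₂ := b :: x) ⟨[c], by simp⟩ ?_
        have := hx.1
        simp; omega
    · have hl := length_of_mem_maximalRuns h
      rcases mem_internalTransform.mp hu with ⟨-, h', -⟩ | rfl | h'
      · omega
      · omega
      · obtain ⟨-, b, x, c, rfl, hx, hbx, hxc⟩ := h
        obtain ⟨-, b', x', c', rfl, hx', hbx', hxc'⟩ := h'
        by_contra hne
        obtain ⟨rfl, hp⟩ := List.cons_prefix_cons.mp htu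
        refine hxc (runs_of_infix hx' ?_ (by have := hx.1; simp; omega))
        rcases List.prefix_concat_iff.mp hp with hp | hp
        · exact absurd (by rw [hp]) hne
        · exact hp.isInfix

theorem isSuffixCode_internalTransform (hz : z ≠ []) :
    IsSuffixCode (internalTransform S z) := by
  refine ⟨(isPrefixCode_internalTransform hz).1, ?_⟩
  intro t ht u hu htu
  have hlen := htu.length_le
  rcases mem_internalTransform.mp ht with ⟨-, h, h1, h2⟩ | rfl | h
  · rcases mem_internalTransform.mp hu with ⟨-, h', -⟩ | rfl | h'
    · exact htu.eq_of_length (h.trans h'.symm)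
    · omega
    · obtain ⟨-, b, x, c, rfl, hx, -⟩ := h'
      refine absurd ?_ h1
      obtain ⟨y, hy⟩ := suffix_of_mem_runs hx
      have hp : z ++ [c] <:+ b :: (x ++ [c]) := ⟨b :: y, by simp [← hy]⟩
      rw [suffix_eq_of_length_eq htu hp (by simp [h])]
      exact List.prefix_append _ _
  · rcases mem_internalTransform.mp hu with ⟨-, -, -, h1⟩ | rfl | h'
    · exact absurd htu h1
    · rfl
    · obtain ⟨-, b, x, c, rfl, hx, -, hxc⟩ := h'
      refine absurd (concat_mem_runs hx ?_) hxc
      refine List.suffix_of_suffix_length_le htu (List.suffix_cons b _) ?_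
      have := hx.1
      simp; omega
  · have hl := length_of_mem_maximalRuns h
    rcases mem_internalTransform.mp hu with ⟨-, h', -⟩ | rfl | h'
    · omega
    · omega
    · obtain ⟨-, b, x, c, rfl, hx, hbx, hxc⟩ := h
      obtain ⟨-, b', x', c', rfl, hx', hbx', hxc'⟩ := h'
      by_contra hne
      have htu' : (b :: x) ++ [c] <:+ (b' :: x') ++ [c'] := htu
      obtain ⟨hp, hc⟩ := append_singleton_suffix_iff.mp htu'
      refine hbx (runs_of_infix hx' ?_ (by have := hx.1; simp; omega))
      rcases List.suffix_cons_iff.mp hp with hp | hp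
      · exact absurd (by simpa [hc] using hp) hne
      · exact hp.isInfix

/-- A word of `S` longer than `z` without prefix in the transformed code has the form `b x` with
`x ∈ runs z`: otherwise the longest prefix of this form is followed by a letter completing it to
a word of `maximalRuns S z`. -/
theorem exists_eq_cons_of_no_prefix (hS : IsFactorial S) {v : List A} (hv : v ∈ S)
    (hl : z.length < v.length) (h : ∀ s ∈ internalTransform S z, ¬ s <+: v) :
    ∃ b x, v = b :: x ∧ x ∈ runs z ∧ b :: x ∉ runs z := by
  have hzv : ¬ z <+: v := h z (mem_internalTransform.mpr (.inr (.inl rfl)))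
  obtain _ | ⟨b, x⟩ := v
  · simp at hl
  have hb : ∀ y, b :: y <+: b :: x → b :: y ∉ runs z := fun y hy hy' =>
    hzv ((prefix_of_mem_runs hy').trans hy)
  refine ⟨b, x, rfl, ?_, hb x List.prefix_rfl⟩
  have key : ∀ n, z.length ≤ n → n ≤ x.length → x.take n ∈ runs z := by
    intro n hn
    induction n, hn using Nat.le_induction with
    | base =>
      intro hn
      have hp : b :: x.take z.length <+: b :: x :=
        List.cons_prefix_cons.mpr ⟨rfl, List.take_prefix _ _⟩
      have hs : z <:+ b :: x.take z.length := by
        by_contra hs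
        exact h _ (mem_internalTransform.mpr (.inl ⟨hS _ hv _ hp.isInfix, by simpa using hn,
          fun hz => hzv (hz.trans hp), hs⟩)) hp
      rw [← suffix_eq_of_length_eq hs (List.suffix_cons b _) (by simpa using hn)]
      exact self_mem_runs z
    | succ n hn ih =>
      intro hn'
      have ih := ih (by omega)
      by_contra hc
      have ht : x.take (n + 1) = x.take n ++ [x[n]] := (List.take_append_getElem (by omega)).symm
      have hp : b :: x.take (n + 1) <+: b :: x :=
        List.cons_prefix_cons.mpr ⟨rfl, List.take_prefix _ _⟩
      refine h _ (mem_internalTransform.mpr (.inr (.inr ⟨hS _ hv _ hp.isInfix, b, x.take n, x[n],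
        by rw [ht], ih, hb _ ?_, ht ▸ hc⟩))) hp
      exact List.cons_prefix_cons.mpr ⟨rfl, List.take_prefix _ _⟩
  simpa using key x.length (by simpa using hl) le_rfl

theorem degree_internalTransform (hS : IsFactorial S) (hz : z ≠ [])
    {y : List A} (hy : y ∈ S) (hyl : y.length = z.length) (hyz : y ≠ z) :
    degree S (internalTransform S z) = (z.length + 1 : ℕ) := by
  refine degree_eq (isSuffixCode_internalTransform hz) ?_ hy hyl ?_
  · intro w hw u v hu hv hnv hvu hC
    obtain ⟨b, x, rfl, hx, -⟩ :=
      exists_eq_cons_of_no_prefix hS (hS _ hw _ hu.isInfix) (by omega) hC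
    refine ⟨z, mem_internalTransform.mpr (.inr (.inl rfl)), prefix_of_mem_runs
      (runs_of_infix hx ?_ hnv)⟩
    rcases List.suffix_cons_iff.mp hv with rfl | hv
    · exact absurd hvu (lt_irrefl _)
    · exact hv.isInfix
  · intro s hs h
    have := h.length_le
    rcases mem_internalTransform.mp hs with ⟨-, h', -⟩ | rfl | h'
    · omega
    · exact hyz (h.eq_of_length hyl.symm).symm
    · have := length_of_mem_maximalRuns h'
      omega

theorem exists_length_lt_of_mem_runs (hS : IsUniformlyRecurrent S)
    {y : List A} (hy : y ∈ S) (hyl : y.length = z.length) (hyz : y ≠ z) :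
    ∃ n, ∀ x ∈ S, x ∈ runs z → x.length < n := by
  obtain ⟨n, -, hn⟩ := hS.2 y hy
  refine ⟨n, fun x hx hr => ?_⟩
  by_contra! h
  have hp := List.take_prefix n x
  exact hyz (hr.2 y ((hn _ (hS.1.1 _ hx _ hp.isInfix) (by simpa using h)).trans hp.isInfix) hyl)

theorem isMaximalBifixCode_internalTransform (hS : IsUniformlyRecurrent S) (hz : z ≠ [])
    (hzS : z ∈ S) {y : List A} (hy : y ∈ S) (hyl : y.length = z.length) (hyz : y ≠ z) :
    IsMaximalBifixCode S (internalTransform S z) := by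
  refine isMaximalBifixCode_of_dense ⟨isPrefixCode_internalTransform hz,
    isSuffixCode_internalTransform hz⟩ ?_ ?_
  · intro t ht
    rcases mem_internalTransform.mp ht with h | rfl | h
    · exact h.1
    · exact hzS
    · exact h.1
  · intro t ht
    obtain ⟨n, hn⟩ := exists_length_lt_of_mem_runs hS hy hyl hyz
    obtain ⟨r, hr, hl⟩ := exists_extension hS.1 ht (n + z.length + 1)
    refine ⟨t ++ r, List.prefix_append _ _, ?_⟩
    by_contra! hC
    obtain ⟨b, x, hx, hxr, -⟩ := exists_eq_cons_of_no_prefix hS.1.1 hr (by simp; omega) hC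
    have h1 := hn x (hS.1.1 _ hr _ (hx ▸ (List.suffix_cons b x).isInfix)) hxr
    have h2 := congrArg List.length hx
    simp at h2
    omega

theorem finite_maximalRuns [Finite A] (hS : IsUniformlyRecurrent S)
    {y : List A} (hy : y ∈ S) (hyl : y.length = z.length) (hyz : y ≠ z) :
    (maximalRuns S z).Finite := by
  obtain ⟨n, hn⟩ := exists_length_lt_of_mem_runs hS hy hyl hyz
  refine finite_of_length_le (n := n + 2) ?_
  rintro _ ⟨ht, b, x, c, rfl, hx, -⟩
  have := hn x (hS.1.1 _ ht _ ⟨[b], [c], by simp⟩) hx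
  simp
  omega

/-! ### Counting -/

theorem finite_wordsOfLength [Finite A] (S : Set (List A)) (n : ℕ) :
    (wordsOfLength S n).Finite :=
  finite_of_length_le fun _ hx => hx.2.le

theorem rightWords_union_leftWords_subset :
    rightWords S z ∪ leftWords S z ⊆ wordsOfLength S (z.length + 1) := by
  rintro x (h | h) <;> exact ⟨h.1, h.2.1⟩

theorem ncard_internalTransform [Finite A] (hT : (maximalRuns S z).Finite) :
    (internalTransform S z).ncard + (rightWords S z ∪ leftWords S z).ncard =
      (wordsOfLength S (z.length + 1)).ncard + ((maximalRuns S z).ncard + 1) := by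
  have hW := finite_wordsOfLength S (z.length + 1)
  have hz : z ∉ maximalRuns S z := fun h => by
    have := length_of_mem_maximalRuns h
    omega
  rw [internalTransform, Set.ncard_union_eq _ (hW.subset Set.sdiff_subset) (hT.insert z),
    Set.ncard_insert_of_notMem hz hT, add_right_comm,
    Set.ncard_sdiff_add_ncard_of_subset rightWords_union_leftWords_subset hW]
  rw [Set.disjoint_left]
  rintro x ⟨hx, -⟩ (rfl | h)
  · have := hx.2
    omega
  · have := hx.2
    have := length_of_mem_maximalRuns h
    omega

theorem ncard_rightWords (S : Set (List A)) (z : List A) :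
    (rightWords S z).ncard = (rightExt S z).ncard := by
  rw [← Set.ncard_image_of_injective (rightExt S z) (f := fun a => z ++ [a])
    fun a b h => by simpa using h]
  congr 1
  ext x
  rw [mem_rightWords]
  constructor
  · rintro ⟨hx, a, rfl⟩
    exact ⟨a, hx, rfl⟩
  · rintro ⟨a, ha, rfl⟩
    exact ⟨ha, a, rfl⟩

theorem ncard_leftWords (S : Set (List A)) (z : List A) :
    (leftWords S z).ncard = (leftExt S z).ncard := by
  rw [← Set.ncard_image_of_injective (leftExt S z) (f := fun a => a :: z)
    fun a b h => by simpa using h]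
  congr 1
  ext x
  rw [mem_leftWords]
  constructor
  · rintro ⟨hx, a, rfl⟩
    exact ⟨a, hx, rfl⟩
  · rintro ⟨a, ha, rfl⟩
    exact ⟨ha, a, rfl⟩

theorem ncard_biExt (S : Set (List A)) (z : List A) :
    {t | t ∈ S ∧ ∃ b c, t = b :: (z ++ [c])}.ncard = (biExt S z).ncard := by
  rw [← Set.ncard_image_of_injective (biExt S z) (f := fun p => p.1 :: (z ++ [p.2]))
    fun p q h => by ext <;> simp_all]
  congr 1
  ext x
  constructor
  · rintro ⟨hx, b, c, rfl⟩
    exact ⟨(b, c), hx, rfl⟩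
  · rintro ⟨⟨b, c⟩, h, rfl⟩
    exact ⟨h, b, c, rfl⟩

/-- A word of length `z.length + 1` with `z` both as prefix and suffix is a power of a letter. -/
theorem eq_replicate_of_concat_eq_cons {b c : A} (h : z ++ [c] = b :: z) :
    z = List.replicate z.length b := by
  induction z with
  | nil => rfl
  | cons d z ih =>
    obtain ⟨rfl, h'⟩ := List.cons_eq_cons.mp (h : d :: (z ++ [c]) = b :: d :: z)
    rw [List.length_cons, List.replicate_succ, ← ih h']

theorem mem_runs_replicate {a : A} {n : ℕ} {x : List A} :
    x ∈ runs (List.replicate (n + 1) a) ↔ ∃ m, n + 1 ≤ m ∧ x = List.replicate m a := by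
  constructor
  · intro hx
    have hn : n + 1 ≤ x.length := by simpa using hx.1
    refine ⟨x.length, hn, List.eq_replicate_iff.mpr ⟨rfl, ?_⟩⟩
    induction x with
    | nil => simp
    | cons b y ih =>
      obtain ⟨t, ht⟩ := prefix_of_mem_runs hx
      have hb : b = a := by
        rw [List.replicate_succ, List.cons_append] at ht
        exact (List.cons_eq_cons.mp ht).1.symm
      intro d hd
      rcases List.mem_cons.mp hd with rfl | hd
      · exact hb
      · by_cases hl : n + 1 ≤ y.length
        · exact ih (runs_of_infix hx (List.suffix_cons b y).isInfix (by simpa using hl)) hl d hd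
        · have : t = [] := by
            have := congrArg List.length ht
            simp at this hl
            exact List.length_eq_zero_iff.mp (by omega)
          subst this
          rw [List.append_nil] at ht
          exact List.eq_of_mem_replicate (ht ▸ List.mem_cons_of_mem b hd)
  · rintro ⟨m, hm, rfl⟩
    refine ⟨by simpa using hm, fun f hf hl => List.eq_replicate_iff.mpr ⟨by simpa using hl, ?_⟩⟩
    exact fun d hd => List.eq_of_mem_replicate (hf.subset hd)

theorem mem_maximalRuns_replicate {a : A} {n : ℕ} {t : List A} :
    t ∈ maximalRuns S (List.replicate (n + 1) a) ↔
      t ∈ S ∧ ∃ b m c, n + 1 ≤ m ∧ b ≠ a ∧ c ≠ a ∧ t = b :: (List.replicate m a ++ [c]) := by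
  refine and_congr_right fun _ => ?_
  simp only [mem_runs_replicate]
  constructor
  · rintro ⟨b, _, c, rfl, ⟨m, hm, rfl⟩, h1, h2⟩
    refine ⟨b, m, c, hm, ?_, ?_, rfl⟩
    · rintro rfl
      exact h1 ⟨m + 1, by omega, by rw [List.replicate_succ]⟩
    · rintro rfl
      exact h2 ⟨m + 1, by omega, by rw [List.replicate_succ']⟩
  · rintro ⟨b, m, c, hm, hb, hc, rfl⟩
    refine ⟨b, _, c, rfl, ⟨m, hm, rfl⟩, ?_, ?_⟩
    · rintro ⟨k, -, hk⟩
      exact hb (List.eq_of_mem_replicate (hk ▸ List.mem_cons_self))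
    · rintro ⟨k, -, hk⟩
      exact hc (List.eq_of_mem_replicate (hk ▸ (by simp : c ∈ List.replicate m a ++ [c])))

/-- The words `b z c` of `S` are those of `maximalRuns S z` when no word of length `z.length + 1`
of `S` has `z` both as prefix and suffix. -/
theorem maximalRuns_eq (hS : IsFactorial S) (h : rightWords S z ∩ leftWords S z = ∅) :
    maximalRuns S z = {t | t ∈ S ∧ ∃ b c, t = b :: (z ++ [c])} := by
  have key : ∀ x ∈ S, x ∈ runs z → x = z := by
    intro x hx hr
    by_contra hne
    have hlt : z.length < x.length := lt_of_le_of_ne hr.1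
      fun hl => hne ((prefix_of_mem_runs hr).eq_of_length hl).symm
    have hp := List.take_prefix (z.length + 1) x
    have hr' := runs_of_infix hr hp.isInfix (by simp; omega)
    have hxS := hS _ hx _ hp.isInfix
    have hl : (x.take (z.length + 1)).length = z.length + 1 := by simpa using hlt
    exact h.subset ⟨⟨hxS, hl, prefix_of_mem_runs hr'⟩, hxS, hl, suffix_of_mem_runs hr'⟩
  ext t
  refine and_congr_right fun ht => ⟨?_, ?_⟩
  · rintro ⟨b, x, c, rfl, hx, -⟩
    obtain rfl := key x (hS _ ht _ ⟨[b], [c], by simp⟩) hx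
    exact ⟨b, c, rfl⟩
  · rintro ⟨b, c, rfl⟩
    refine ⟨b, z, c, rfl, self_mem_runs z, fun hr => ?_, fun hr => ?_⟩
    · have := congrArg List.length (key _ (hS _ ht _ ⟨[], [c], by simp⟩) hr)
      simp at this
    · have := congrArg List.length (key _ (hS _ ht _ ⟨[b], [], by simp⟩) hr)
      simp at this

theorem rightWords_inter_leftWords_replicate {a : A} {n : ℕ}
    (h : List.replicate (n + 2) a ∈ S) :
    rightWords S (List.replicate (n + 1) a) ∩ leftWords S (List.replicate (n + 1) a) =
      {List.replicate (n + 2) a} := by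
  ext x
  rw [Set.mem_inter_iff, mem_rightWords, mem_leftWords, Set.mem_singleton_iff]
  constructor
  · rintro ⟨⟨-, c, rfl⟩, -, b, hb⟩
    obtain rfl : a = b := by
      rw [List.replicate_succ] at hb
      exact (List.cons_eq_cons.mp hb).1
    rw [hb, ← List.replicate_succ]
  · rintro rfl
    exact ⟨⟨h, a, List.replicate_succ'⟩, h, a, List.replicate_succ⟩

theorem maximalRuns_replicate (S : Set (List A)) (a : A) (n : ℕ) :
    maximalRuns S (List.replicate (n + 1) a) = maximalRuns S (List.replicate (n + 2) a) ∪
      {t | t ∈ S ∧ ∃ b c, b ≠ a ∧ c ≠ a ∧ t = b :: (List.replicate (n + 1) a ++ [c])} := by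
  ext t
  simp only [Set.mem_union, mem_maximalRuns_replicate, Set.mem_ofPred_eq]
  constructor
  · rintro ⟨ht, b, m, c, hm, hb, hc, rfl⟩
    rcases eq_or_lt_of_le hm with rfl | hm
    · exact .inr ⟨ht, b, c, hb, hc, rfl⟩
    · exact .inl ⟨ht, b, m, c, hm, hb, hc, rfl⟩
  · rintro (⟨ht, b, m, c, hm, hb, hc, rfl⟩ | ⟨ht, b, c, hb, hc, rfl⟩)
    · exact ⟨ht, b, m, c, by omega, hb, hc, rfl⟩
    · exact ⟨ht, b, n + 1, c, le_rfl, hb, hc, rfl⟩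

theorem biWords_replicate (S : Set (List A)) (a : A) (n : ℕ) :
    {t | t ∈ S ∧ ∃ b c, t = b :: (List.replicate (n + 1) a ++ [c])} =
      (rightWords S (List.replicate (n + 2) a) ∪ leftWords S (List.replicate (n + 2) a)) ∪
      {t | t ∈ S ∧ ∃ b c, b ≠ a ∧ c ≠ a ∧ t = b :: (List.replicate (n + 1) a ++ [c])} := by
  ext t
  rw [Set.mem_union, Set.mem_union, mem_rightWords, mem_leftWords]
  constructor
  · rintro ⟨ht, b, c, rfl⟩
    by_cases hb : b = a
    · subst hb
      exact .inl (.inl ⟨ht, c, by rw [List.replicate_succ (n := n + 1)]; rfl⟩)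
    by_cases hc : c = a
    · subst hc
      exact .inl (.inr ⟨ht, b, by rw [← List.replicate_succ']⟩)
    exact .inr ⟨ht, b, c, hb, hc, rfl⟩
  · rintro ((⟨ht, c, rfl⟩ | ⟨ht, b, rfl⟩) | ⟨ht, b, c, -, -, rfl⟩)
    · exact ⟨ht, a, c, by rw [List.replicate_succ (n := n + 1)]; rfl⟩
    · exact ⟨ht, b, a, by rw [← List.replicate_succ']⟩
    · exact ⟨ht, b, c, rfl⟩

/-! ### Multiplicities -/

/-- Over a one-letter alphabet, all words have multiplicity zero. -/
theorem wordMult_of_subsingleton [Subsingleton A] [Nonempty A] (hS : IsRightExtendable S)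
    (h0 : [] ∈ S) (w : List A) : wordMult S w = 0 := by
  have hall : ∀ w : List A, w ∈ S := by
    intro w
    obtain ⟨t, ht, hl⟩ := exists_extension hS h0 w.length
    convert ht
    exact List.ext_getElem (by simpa using hl.symm) fun _ _ _ => Subsingleton.elim _ _
  simp [wordMult, biExt, leftExt, rightExt, hall, Set.ncard_univ]

theorem exists_ne_of_nontrivial [Nontrivial A] (hS : IsRightExtendable S)
    (hA : ∀ a : A, [a] ∈ S) (hz : z ≠ []) :
    ∃ y ∈ S, y.length = z.length ∧ y ≠ z := by
  obtain ⟨a, z, rfl⟩ := List.exists_cons_of_ne_nil hz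
  obtain ⟨b, hb⟩ := exists_ne a
  obtain ⟨t, ht, hl⟩ := exists_extension hS (hA b) z.length
  exact ⟨[b] ++ t, ht, by simp [hl], fun h => hb (by simpa using congrArg List.head? h)⟩

/-- If the internal transformation has as many elements as the code of words of length
`z.length + 1`, then `z` and the words of `maximalRuns S z` are as many as the words they
replace. -/
theorem ncard_maximalRuns [Fintype A] [Nontrivial A] (hS : IsUniformlyRecurrent S)
    (hA : ∀ a : A, [a] ∈ S)
    (hcard : ∀ (d : ℕ) (X : Set (List A)), X.Finite → IsMaximalBifixCode S X →
      degree S X = d → X.ncard = d * (Fintype.card A - 1) + 1)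
    (hzS : z ∈ S) (hz : z ≠ []) :
    (rightWords S z ∪ leftWords S z).ncard = (maximalRuns S z).ncard + 1 := by
  obtain ⟨y, hy, hyl, hyz⟩ := exists_ne_of_nontrivial hS.1 hA hz
  have hT := finite_maximalRuns hS hy hyl hyz
  have h0 : [] ∈ S := hS.1.1 _ hzS _ (List.nil_infix)
  have h1 := hcard _ _ (finite_wordsOfLength S _)
    (isMaximalBifixCode_wordsOfLength hS.1 z.length) (degree_wordsOfLength hS.1 h0 _)
  have h2 := hcard _ (internalTransform S z)
    (((finite_wordsOfLength S _).subset Set.sdiff_subset).union (hT.insert z))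
    (isMaximalBifixCode_internalTransform hS hz hzS hy hyl hyz)
    (degree_internalTransform hS.1.1 hz hy hyl hyz)
  have h3 := ncard_internalTransform hT
  omega

theorem wordMult_of_ne_nil [Fintype A] [Nontrivial A] (hS : IsUniformlyRecurrent S)
    (hA : ∀ a : A, [a] ∈ S)
    (hcard : ∀ (d : ℕ) (X : Set (List A)), X.Finite → IsMaximalBifixCode S X →
      degree S X = d → X.ncard = d * (Fintype.card A - 1) + 1)
    (hzS : z ∈ S) (hz : z ≠ []) : wordMult S z = 0 := by
  have hfin : ∀ z : List A, (rightWords S z ∪ leftWords S z).Finite := fun z =>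
    (finite_wordsOfLength S (z.length + 1)).subset rightWords_union_leftWords_subset
  have hz1 := ncard_maximalRuns hS hA hcard hzS hz
  have hz2 := Set.ncard_union_add_ncard_inter (rightWords S z) (leftWords S z)
    ((hfin z).subset Set.subset_union_left) ((hfin z).subset Set.subset_union_right)
  rw [ncard_rightWords, ncard_leftWords] at hz2
  rw [wordMult]
  rcases (rightWords S z ∩ leftWords S z).eq_empty_or_nonempty with he | ⟨x, hx⟩
  · rw [he, Set.ncard_empty] at hz2
    rw [maximalRuns_eq hS.1.1 he, ncard_biExt] at hz1
    omega
  · -- Here `z` is a power of a letter `a` and `z a` is in `S`; the transformations relative to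
    -- `z` and to `z a` are compared.
    obtain ⟨a, n, rfl, ha⟩ : ∃ a n, z = List.replicate (n + 1) a ∧
        List.replicate (n + 2) a ∈ S := by
      rw [Set.mem_inter_iff, mem_rightWords, mem_leftWords] at hx
      obtain ⟨⟨hxS, c, hc⟩, -, a, rfl⟩ := hx
      have hr := eq_replicate_of_concat_eq_cons hc.symm
      obtain ⟨n, hn⟩ := Nat.exists_eq_succ_of_ne_zero (List.length_pos_iff.mpr hz).ne'
      rw [hn] at hr
      refine ⟨a, n, hr, ?_⟩
      rw [List.replicate_succ, ← Nat.succ_eq_add_one, ← hr]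
      exact hxS
    rw [rightWords_inter_leftWords_replicate ha, Set.ncard_singleton] at hz2
    have hne : List.replicate (n + 2) a ≠ [] := by simp
    have hz3 := ncard_maximalRuns hS hA hcard ha hne
    obtain ⟨y, hy, hyl, hyz⟩ := exists_ne_of_nontrivial hS.1 hA hne
    have hE : {t | t ∈ S ∧ ∃ b c, b ≠ a ∧ c ≠ a ∧
        t = b :: (List.replicate (n + 1) a ++ [c])}.Finite := by
      refine finite_of_length_le (n := n + 3) ?_
      rintro _ ⟨-, b, c, -, -, rfl⟩
      simp
    have hz4 := congrArg Set.ncard (maximalRuns_replicate S a n)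
    rw [Set.ncard_union_eq _ (finite_maximalRuns hS hy hyl hyz) hE] at hz4
    · have hz5 := congrArg Set.ncard (biWords_replicate S a n)
      rw [Set.ncard_union_eq _ (hfin _) hE, ncard_biExt] at hz5
      · omega
      · rw [Set.disjoint_left]
        rintro _ h ⟨-, b, c, hb, hc, rfl⟩
        rcases h with ⟨-, -, h⟩ | ⟨-, -, h⟩
        · rw [List.replicate_succ] at h
          exact hb (List.cons_prefix_cons.mp h).1.symm
        · rw [List.replicate_succ', ← List.cons_append,
            append_singleton_suffix_iff] at h
          exact hc h.2.symm
    · rw [Set.disjoint_left]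
      rintro _ h ⟨-, b, c, -, -, rfl⟩
      have := length_of_mem_maximalRuns h
      simp at this

theorem wordMult_nil [Fintype A] [Nonempty A] (hS : IsUniformlyRecurrent S)
    (hA : ∀ a : A, [a] ∈ S)
    (hcard : ∀ (d : ℕ) (X : Set (List A)), X.Finite → IsMaximalBifixCode S X →
      degree S X = d → X.ncard = d * (Fintype.card A - 1) + 1)
    (h0 : [] ∈ S) : wordMult S [] = 0 := by
  have h := hcard _ _ (finite_wordsOfLength S _)
    (isMaximalBifixCode_wordsOfLength hS.1 1) (degree_wordsOfLength hS.1 h0 _)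
  have h2 : wordsOfLength S (1 + 1) = {t | t ∈ S ∧ ∃ b c, t = b :: ([] ++ [c])} := by
    ext t
    refine and_congr_right fun _ => ?_
    rw [List.length_eq_two]
    rfl
  rw [h2, ncard_biExt] at h
  have hpos : 0 < Fintype.card A := Fintype.card_pos
  simp only [wordMult, h]
  simp [leftExt, rightExt, hA, Set.ncard_univ]
  omega

end BifixWords

theorem mainTheorem3 {A : Type*} [Fintype A] [Nonempty A] (S : Set (List A))
    (hS : BifixWords.IsUniformlyRecurrent S)
    (hA : ∀ a : A, [a] ∈ S)
    (hcard : ∀ (d : ℕ) (X : Set (List A)), X.Finite → BifixWords.IsMaximalBifixCode S X →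
      BifixWords.degree S X = d → X.ncard = d * (Fintype.card A - 1) + 1) :
    BifixWords.IsNeutral S := by
  have h0 : [] ∈ S := hS.1.1 [Classical.arbitrary A] (hA _) _ List.nil_infix
  refine ⟨hS.1.1, fun w hw => ?_⟩
  rcases subsingleton_or_nontrivial A with h | h
  · exact BifixWords.wordMult_of_subsingleton hS.1 h0 w
  · rcases eq_or_ne w [] with rfl | hne
    · exact BifixWords.wordMult_nil hS hA hcard h0
    · exact BifixWords.wordMult_of_ne_nil hS hA hcard hw hne
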